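/- Let $X$ be a real Hausdorff locally convex topological vector space, let $K$ be a nonempty convex compact subset of $X$, and let $D\subseteq K$ be self segment-dense in $K$, that is, $K\subseteq\operatorname{cl}(D)$ and, for all $x,y\in D$, the set $[x,y]\cap D$ is dense in the closed line segment $[x,y]$. Let $\varphi:K\times K\to\mathbb{R}$ be a function satisfying (i) for every $y\in D$, the function $x\mapsto\varphi(x,y)$ is upper semicontinuous on $K$; (ii) for every $x\in K$, the function $y\mapsto\varphi(x,y)$, defined on $K$, is upper semicontinuous at every point of $K\setminus D$; (iii) for every $x\in D$, the function $y\mapsto\varphi(x,y)$ is convex on $D$, in the sense that for all $n\ge 1$, all $y_1,\dots,y_n\in D$ and all $\lambda_1,\dots,\lambda_n\ge 0$ with $\sum_{i=1}^n\lambda_i=1$ and $\sum_{i=1}^n\lambda_i y_i\in D$ one has $\varphi\left(x,\sum_{i=1}^n\lambda_i y_i\right)\le\sum_{i=1}^n\lambda_i\varphi(x,y_i)$; (iv) $\varphi(x,x)\ge 0$ for every $x\in D$. Then there exists $x_0\in K$ such that $\varphi(x_0,y)\ge 0$ for all $y\in K$. -/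

import Mathlib

/-- For a convex set `V` in a real topological vector space, `U ⊆ V` is *self segment-dense* in `V`
if `U` is dense in `V` and, for all `x y ∈ U`, the set `[x, y] ∩ U` is dense in the closed segment
`[x, y]`. Here `P` is dense in `S` means `S ⊆ closure P`. -/
structure IsSelfSegmentDense {X : Type*} [AddCommGroup X] [Module ℝ X] [TopologicalSpace X]
    (U V : Set X) : Prop where
  subset : U ⊆ V
  dense : V ⊆ closure U
  segment_dense : ∀ x ∈ U, ∀ y ∈ U, segment ℝ x y ⊆ closure (segment ℝ x y ∩ U)

/-- Convexity of a real function on a set `D` that need not be convex: Jensen's inequality holds for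
every finite convex combination of points of `D` that lies again in `D`. -/
def IsConvexFunctionOn {X : Type*} [AddCommGroup X] [Module ℝ X] (D : Set X) (f : X → ℝ) : Prop :=
  ∀ (n : ℕ) (x : Fin n → X) (w : Fin n → ℝ),
    (∀ i, x i ∈ D) → (∀ i, 0 ≤ w i) → ∑ i, w i = 1 → ∑ i, w i • x i ∈ D →
      f (∑ i, w i • x i) ≤ ∑ i, w i * f (x i)

/-! For `y ∈ D` put `G y = {x ∈ K | 0 ≤ φ x y}`, a closed subset of the compact set `K`. A point of
`D` in the hull of finitely many `y`'s in `D` lies in one of their `G y`: otherwise Jensen's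
inequality would make `φ x x` negative. This uses `x ∈ D`, but a finite union of closed sets also
contains the closure, and self segment-density makes `D` dense in such hulls
(`IsSelfSegmentDense.convexHull_subset_closure`). So the KKM lemma applies, finitely many `G y`
always meet in `K`, and compactness gives `x₀` in all of them. Semicontinuity in `y` passes from `D`
to `K`.

KKM is proved combinatorially. Scarf's lemma, a Sperner-type parity argument on ranked finite sets,
is applied to lattice points of a dilated simplex. Rescaling and compactness then give a covering
theorem on the simplex, and distance functions turn it into KKM. -/

open Finset in
/-- Parity principle behind Sperner-type lemmas: if every set of size `|I| - 1` lies in an even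
number of members of a family of `|I|`-element sets, then the number of members carrying all
colours is even. -/
theorem even_card_rainbow {V I : Type*} [Fintype V] [DecidableEq V] [Fintype I] [DecidableEq I]
    (R : Finset (Finset V)) (c : V → I) (i₀ : I) (hcard : ∀ s ∈ R, #s = Fintype.card I)
    (hdoor : ∀ d : Finset V, #d + 1 = Fintype.card I → Even #{s ∈ R | d ⊆ s}) :
    Even #{s ∈ R | s.image c = univ} := by
  classical
  set t : Finset (Finset V) :=
    {d | #d + 1 = Fintype.card I ∧ d.image c = univ.erase i₀} with ht
  have hdouble := sum_card_bipartiteAbove_eq_sum_card_bipartiteBelow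
    (s := R) (t := t) (fun s d => d ⊆ s)
  have hright : Even (∑ d ∈ t, #(bipartiteBelow (fun s d => d ⊆ s) R d)) :=
    Finset.even_sum _ fun d hd => hdoor d (by simp [ht] at hd; exact hd.1)
  have hfacets : ∀ s ∈ R, #(bipartiteAbove (fun s d => d ⊆ s) t s) =
      #{x ∈ s | (s.erase x).image c = univ.erase i₀} := by
    intro s hs
    rw [← card_image_of_injOn (f := s.erase) (s := {x ∈ s | _})]
    · congr 1
      ext d
      simp only [bipartiteAbove, ht, mem_filter, mem_univ, true_and, mem_image]
      constructor
      · rintro ⟨⟨h1, h2⟩, h3⟩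
        have h4 : #(s \ d) = 1 := by
          have := card_sdiff_add_card_eq_card h3
          have := hcard s hs
          omega
        obtain ⟨x, hx⟩ := card_eq_one.1 h4
        have hxs : x ∈ s ∧ x ∉ d := by
          rw [← mem_sdiff, hx]; simp
        have hd : s.erase x = d := by
          rw [erase_eq, ← hx, Finset.sdiff_sdiff_eq_self h3]
        exact ⟨x, ⟨hxs.1, hd ▸ h2⟩, hd⟩
      · rintro ⟨x, ⟨h1, h2⟩, rfl⟩
        refine ⟨⟨?_, h2⟩, erase_subset _ _⟩
        rw [card_erase_add_one h1, hcard s hs]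
    · intro x hx y hy hxy
      simp only [coe_filter, Set.mem_ofPred_eq] at hx hy
      exact erase_injOn s hx.1 hy.1 hxy
  -- A rainbow `s` has one facet missing exactly `i₀`. Any other `s` has none or two: if deleting
  -- `x` gives such a facet, so does deleting the one other point sharing the colour of `x`.
  have hlocal : ∀ s ∈ R, (#(bipartiteAbove (fun s d => d ⊆ s) t s) : ZMod 2) =
      if s.image c = univ then 1 else 0 := by
    intro s hs
    rw [hfacets s hs]
    split_ifs with h
    · have hinj : Set.InjOn c s := by
        rw [← card_image_iff, h, hcard s hs, card_univ]
      obtain ⟨x, hx, hcx⟩ : ∃ x ∈ s, c x = i₀ := by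
        have := mem_univ i₀
        rw [← h] at this
        simpa using this
      have : ({x ∈ s | (s.erase x).image c = univ.erase i₀} : Finset V) = {x} := by
        ext y
        simp only [mem_filter, mem_singleton]
        constructor
        · rintro ⟨hy, hi⟩
          by_contra hne
          have : c x ∈ (s.erase y).image c :=
            mem_image_of_mem _ (mem_erase.2 ⟨fun h => hne h.symm, hx⟩)
          rw [hi, hcx] at this
          simp at this
        · rintro rfl
          refine ⟨hx, ?_⟩
          ext i
          simp only [mem_image, mem_erase, mem_univ, and_true]
          constructor
          · rintro ⟨z, ⟨hz, hzs⟩, rfl⟩ h0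
            exact hz (hinj hzs hx (h0.trans hcx.symm))
          · intro hi
            have := mem_univ i
            rw [← h] at this
            obtain ⟨z, hz, rfl⟩ := mem_image.1 this
            exact ⟨z, ⟨fun h => hi (h ▸ hcx), hz⟩, rfl⟩
      rw [this]; simp
    · rw [ZMod.natCast_eq_zero_iff_even]
      rcases Finset.eq_empty_or_nonempty
        ({x ∈ s | (s.erase x).image c = univ.erase i₀} : Finset V) with h0 | ⟨x, hx⟩
      · rw [h0]; simp
      obtain ⟨hxs, hxi⟩ := mem_filter.1 hx
      have hinj : Set.InjOn c (s.erase x) := by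
        rw [← card_image_iff, hxi, card_erase_of_mem hxs, card_erase_of_mem (mem_univ _),
          hcard s hs, card_univ]
      have hmem : ∀ i, i ≠ i₀ → ∃ z ∈ s, z ≠ x ∧ c z = i := by
        intro i hi
        have : i ∈ univ.erase i₀ := by simp [hi]
        rw [← hxi] at this
        obtain ⟨z, hz, rfl⟩ := mem_image.1 this
        exact ⟨z, (mem_erase.1 hz).2, (mem_erase.1 hz).1, rfl⟩
      have hne : ∀ z ∈ s, z ≠ x → c z ≠ i₀ := by
        intro z hz hzx
        have : c z ∈ (s.erase x).image c := mem_image_of_mem _ (mem_erase.2 ⟨hzx, hz⟩)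
        rw [hxi] at this
        exact (mem_erase.1 this).1
      have hcx : c x ≠ i₀ := by
        intro h0
        apply h
        ext i
        simp only [mem_image, mem_univ, iff_true]
        by_cases hi : i = i₀
        · exact ⟨x, hxs, h0.trans hi.symm⟩
        · obtain ⟨z, hz, -, hzi⟩ := hmem i hi
          exact ⟨z, hz, hzi⟩
      obtain ⟨x', hx's, hx'x, hcx'⟩ := hmem _ hcx
      have : ({x ∈ s | (s.erase x).image c = univ.erase i₀} : Finset V) = {x, x'} := by
        ext y
        simp only [mem_filter, mem_singleton, mem_insert]
        constructor
        · rintro ⟨hy, hyi⟩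
          by_cases hyx : y = x
          · exact Or.inl hyx
          right
          have : c y ∈ univ.erase i₀ := by simp [hne y hy hyx]
          rw [← hyi] at this
          obtain ⟨z, hz, hzy⟩ := mem_image.1 this
          obtain ⟨hz1, hz2⟩ := mem_erase.1 hz
          by_cases hzx : z = x
          · subst hzx
            exact hinj (mem_coe.2 (mem_erase.2 ⟨hyx, hy⟩))
              (mem_coe.2 (mem_erase.2 ⟨hx'x, hx's⟩)) (hzy.symm.trans hcx'.symm)
          · exact absurd (hinj (mem_coe.2 (mem_erase.2 ⟨hzx, hz2⟩))
              (mem_coe.2 (mem_erase.2 ⟨hyx, hy⟩)) hzy) hz1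
        · rintro (rfl | rfl)
          · exact ⟨hxs, hxi⟩
          · refine ⟨hx's, ?_⟩
            ext i
            simp only [mem_image, mem_erase, mem_univ, and_true]
            constructor
            · rintro ⟨z, ⟨hz, hzs⟩, rfl⟩
              by_cases hzx : z = x
              · rw [hzx]; exact hcx
              · exact hne z hzs hzx
            · intro hi
              obtain ⟨z, hz, hzx, rfl⟩ := hmem i hi
              by_cases hzy : z = y
              · exact ⟨x, ⟨Ne.symm hx'x, hxs⟩, by rw [hzy, hcx']⟩
              · exact ⟨z, ⟨hzy, hz⟩, rfl⟩
      rw [this, card_pair (Ne.symm hx'x)]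
      exact even_two
  rw [← ZMod.natCast_eq_zero_iff_even, card_filter, Nat.cast_sum]
  rw [← hdouble, ← ZMod.natCast_eq_zero_iff_even, Nat.cast_sum] at hright
  rw [← hright]
  exact sum_congr rfl fun s hs => by rw [hlocal s hs]; simp

/-! ### Dominant sets and their one-point extensions -/

/-- A set `d` is dominant for rank functions `r i` if no point lies above all of `d` in every rank. -/
def IsDominant {V I : Type*} (r : I → V → ℕ) (d : Finset V) : Prop :=
  ∀ y, ∃ i, ∀ x ∈ d, r i y ≤ r i x

theorem IsDominant.mono {V I : Type*} {r : I → V → ℕ} {d s : Finset V} (h : IsDominant r s)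
    (hd : d ⊆ s) : IsDominant r d := fun y =>
  let ⟨i, hi⟩ := h y
  ⟨i, fun x hx => hi x (hd hx)⟩

/-- Dominance tested at a point of `d` itself makes that point the minimum of `d` in some rank. -/
theorem IsDominant.image_eq {V I : Type*} [DecidableEq V] [Fintype I] {r : I → V → ℕ}
    (hr : ∀ i, Function.Injective (r i)) {d : Finset V} (h : IsDominant r d) {m : I → V}
    (hm : ∀ i, m i ∈ d) (hle : ∀ i, ∀ x ∈ d, r i (m i) ≤ r i x) : Finset.univ.image m = d := by
  ext x
  simp only [Finset.mem_image, Finset.mem_univ, true_and]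
  constructor
  · rintro ⟨i, rfl⟩; exact hm i
  · intro hx
    obtain ⟨i, hi⟩ := h x
    exact ⟨i, hr i (le_antisymm (hle i x hx) (hi _ (hm i)))⟩

theorem exists_minimizers {V I : Type*} (r : I → V → ℕ) {d : Finset V} (hd : d.Nonempty) :
    ∃ m : I → V, (∀ i, m i ∈ d) ∧ ∀ i, ∀ x ∈ d, r i (m i) ≤ r i x := by
  choose m h1 h2 using fun i => d.exists_min_image (r i) hd
  exact ⟨m, h1, h2⟩

/-- `x` is the `k`-largest point among those strictly above all `m l` with `l ≠ k`. -/
def IsPivot {V I : Type*} (r : I → V → ℕ) (m : I → V) (k : I) (x : V) : Prop :=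
  (∀ l, l ≠ k → r l (m l) < r l x) ∧
    ∀ y, (∀ l, l ≠ k → r l (m l) < r l y) → r k y ≤ r k x

theorem exists_isPivot {V I : Type*} [Finite V] (r : I → V → ℕ) (m : I → V) (k : I)
    (h : ∃ y, ∀ l, l ≠ k → r l (m l) < r l y) : ∃ x, IsPivot r m k x := by
  obtain ⟨x, hx, hmax⟩ := Set.exists_max_image {y | ∀ l, l ≠ k → r l (m l) < r l y} (r k)
    (Set.toFinite _) h
  exact ⟨x, hx, hmax⟩

theorem IsPivot.eq {V I : Type*} {r : I → V → ℕ} {m : I → V} (hr : ∀ i, Function.Injective (r i)) {k : I} {x y : V}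
    (hx : IsPivot r m k x) (hy : IsPivot r m k y) : x = y :=
  hr k (le_antisymm (hy.2 x hx.1) (hx.2 y hy.1))

theorem IsPivot.ne {V I : Type*} {r : I → V → ℕ} {d : Finset V} {m : I → V}
    (h : IsDominant r d) (hm : ∀ i, m i ∈ d) {i j : I} (hij : i ≠ j) {x y : V}
    (hx : IsPivot r m i x) (hy : IsPivot r m j y) : x ≠ y := by
  rintro rfl
  obtain ⟨l, hl⟩ := h x
  by_cases hli : l = i
  · exact absurd (hy.1 l (hli ▸ hij)) (not_lt.2 (hl _ (hm l)))
  · exact absurd (hx.1 l hli) (not_lt.2 (hl _ (hm l)))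

section Doors

variable {V I : Type*} [DecidableEq V] [Fintype I] {r : I → V → ℕ} {d : Finset V}
  {m : I → V}

theorem exists_common_minimizer (hr : ∀ i, Function.Injective (r i)) (h : IsDominant r d)
    (hcard : d.card + 1 = Fintype.card I)
    (hm : ∀ i, m i ∈ d) (hle : ∀ i, ∀ x ∈ d, r i (m i) ≤ r i x) : ∃ i j, i ≠ j ∧ m i = m j := by
  by_contra! hne
  have hinj : Function.Injective m := fun i j hij => by
    by_contra h'
    exact hne i j h' hij
  have := Finset.card_image_of_injective Finset.univ hinj
  rw [h.image_eq hr hm hle, Finset.card_univ] at this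
  omega

theorem exists_minimizer_ne (hr : ∀ i, Function.Injective (r i)) (h : IsDominant r d)
    (hm : ∀ i, m i ∈ d) (hle : ∀ i, ∀ x ∈ d, r i (m i) ≤ r i x) {i j : I} (hij : i ≠ j)
    (hmij : m i = m j) {x : V} (hx : x ∈ d) : ∃ l, l ≠ i ∧ m l = x := by
  rw [← h.image_eq hr hm hle] at hx
  obtain ⟨l, -, rfl⟩ := Finset.mem_image.1 hx
  by_cases hl : l = i
  · exact ⟨j, hij.symm, by rw [hl, hmij]⟩
  · exact ⟨l, hl, rfl⟩

theorem IsPivot.notMem (hr : ∀ i, Function.Injective (r i)) (h : IsDominant r d)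
    (hm : ∀ i, m i ∈ d) (hle : ∀ i, ∀ x ∈ d, r i (m i) ≤ r i x) {i j : I} (hij : i ≠ j)
    (hmij : m i = m j) {x : V} (hx : IsPivot r m i x) : x ∉ d := by
  intro hxd
  obtain ⟨l, hl, rfl⟩ := exists_minimizer_ne hr h hm hle hij hmij hxd
  exact lt_irrefl _ (hx.1 l hl)

/-- A point `y` above every `m l` with `l ≠ k` is below `x` in rank `k` by maximality, and `x` can
be below `d` only in rank `k`. Any other `y` is already below some `m l` with `l ≠ k`, hence below
`x` too. -/
theorem IsPivot.isDominant_insert (h : IsDominant r d)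
    (hm : ∀ i, m i ∈ d) (hle : ∀ i, ∀ x ∈ d, r i (m i) ≤ r i x) {k : I}
    {x : V} (hx : IsPivot r m k x) : IsDominant r (insert x d) := by
  intro y
  by_cases hy : ∀ l, l ≠ k → r l (m l) < r l y
  · refine ⟨k, fun z hz => ?_⟩
    have hyx := hx.2 y hy
    rcases Finset.mem_insert.1 hz with rfl | hz
    · exact hyx
    · obtain ⟨l, hl⟩ := h x
      have : l = k := by
        by_contra hlk
        exact absurd (hx.1 l hlk) (not_lt.2 (hl _ (hm l)))
      subst this
      exact hyx.trans (hl z hz)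
  · push Not at hy
    obtain ⟨l, hlk, hl⟩ := hy
    refine ⟨l, fun z hz => ?_⟩
    rcases Finset.mem_insert.1 hz with rfl | hz
    · exact hl.trans (hx.1 l hlk).le
    · exact hl.trans (hle l z hz)

/-- By cardinality the minimizers of `insert x d` are distinct, so `x` replaces exactly one `m k`.
The collision `m i = m j` must disappear, which forces `k` to be `i` or `j`. -/
theorem isPivot_of_isDominant_insert (hr : ∀ i, Function.Injective (r i))
    (hcard : d.card + 1 = Fintype.card I)
    (hm : ∀ i, m i ∈ d) (hle : ∀ i, ∀ x ∈ d, r i (m i) ≤ r i x) {i j : I} (hij : i ≠ j)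
    (hmij : m i = m j) {x : V} (hxd : x ∉ d) (hx : IsDominant r (insert x d)) :
    IsPivot r m i x ∨ IsPivot r m j x := by
  obtain ⟨m', hm', hle'⟩ := exists_minimizers r (Finset.insert_nonempty x d)
  have himg := hx.image_eq hr hm' hle'
  have hinj : Function.Injective m' := by
    rw [← Set.injOn_univ, ← Finset.coe_univ, ← Finset.card_image_iff, himg,
      Finset.card_insert_of_notMem hxd, hcard, Finset.card_univ]
  obtain ⟨k, -, hk⟩ : ∃ k ∈ Finset.univ, m' k = x :=
    Finset.mem_image.1 (himg ▸ Finset.mem_insert_self x d)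
  have hmm' : ∀ l, l ≠ k → m' l = m l := by
    intro l hl
    have hne : m' l ≠ x := fun h => hl (hinj (h.trans hk.symm))
    have hmem := (Finset.mem_insert.1 (hm' l)).resolve_left hne
    exact hr l (le_antisymm (hle' l _ (Finset.mem_insert_of_mem (hm l))) (hle l _ hmem))
  have hpivot : IsPivot r m k x := by
    constructor
    · intro l hl
      rw [← hmm' l hl]
      refine lt_of_le_of_ne (hle' l x (Finset.mem_insert_self x d)) fun h => hl ?_
      exact hinj ((hr l h).trans hk.symm)
    · intro y hy
      obtain ⟨l, hl⟩ := hx y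
      by_cases hlk : l = k
      · subst hlk; exact hl x (Finset.mem_insert_self x d)
      · exact absurd (hy l hlk) (not_lt.2 (hl _ (Finset.mem_insert_of_mem (hm l))))
  by_cases hki : k = i
  · left; rwa [← hki]
  by_cases hkj : k = j
  · right; rwa [← hkj]
  · refine absurd (hinj ?_) hij
    rw [hmm' i (Ne.symm hki), hmm' j (Ne.symm hkj), hmij]

end Doors

/-! ### Slack points and Scarf's lemma -/

/-- `slack i` is the smallest point for rank `i`, and above all ordinary points for the others. -/
structure IsSlack {V I : Type*} (r : I → V → ℕ) (slack : I → V) : Prop where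
  bot : ∀ i v, v ≠ slack i → r i (slack i) < r i v
  top : ∀ i j v, j ≠ i → v ∉ Set.range slack → r i v < r i (slack j)

-- A dominant `d` containing an ordinary point has exactly two extensions, one for each of the two
-- indices sharing a minimizer. A `d` made of slack points has a single dominant extension;
-- admitting the slack set itself as a room supplies the second. Any other `d` has none.
open Finset in
theorem even_card_rooms {V I : Type*} [Fintype V] [DecidableEq V] [Fintype I] [DecidableEq I]
    [Nontrivial I] {r : I → V → ℕ} (hr : ∀ i, Function.Injective (r i)) {slack : I → V}
    (hinj : Function.Injective slack) (hs : IsSlack r slack) (hV : ∃ v, v ∉ Set.range slack)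
    [DecidablePred (fun s : Finset V => #s = Fintype.card I ∧
      (IsDominant r s ∨ s = univ.image slack))]
    (d : Finset V) (hcard : #d + 1 = Fintype.card I) :
    Even #{s ∈ ({s | #s = Fintype.card I ∧ (IsDominant r s ∨ s = univ.image slack)} :
      Finset (Finset V)) | d ⊆ s} := by
  have hI : 1 < Fintype.card I := Fintype.one_lt_card
  have hdne : d.Nonempty := card_pos.1 (by omega)
  have hinsert : ∀ s : Finset V, #s = Fintype.card I → d ⊆ s → ∃ x, x ∉ d ∧ s = insert x d := by
    intro s h1 h2
    obtain ⟨x, hx⟩ := (covBy_iff_card_sdiff_eq_one (t := d) (s := s)).2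
      ⟨h2, by have := card_sdiff_add_card_eq_card h2; omega⟩ |>.exists_finset_insert
    exact ⟨x, hx.1, hx.2.symm⟩
  obtain ⟨m, hm, hle⟩ := exists_minimizers r hdne
  by_cases hdS : d ⊆ univ.image slack
  · have hScard : #(univ.image slack) = Fintype.card I := by
      rw [card_image_of_injective _ hinj, card_univ]
    obtain ⟨z, hzd, hz⟩ := hinsert _ hScard hdS
    obtain ⟨i₀, -, rfl⟩ := mem_image.1 (hz ▸ mem_insert_self z d)
    have hmem : ∀ l, l ≠ i₀ → slack l ∈ d := by
      intro l hl
      have : slack l ∈ univ.image slack := mem_image_of_mem _ (mem_univ _)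
      rw [hz] at this
      exact (mem_insert.1 this).resolve_left fun h => hl (hinj h)
    have hml : ∀ l, l ≠ i₀ → m l = slack l := by
      intro l hl
      by_contra hne
      exact absurd (hs.bot l _ hne) (not_lt.2 (hle l _ (hmem l hl)))
    have hslack : ∀ x ∈ d, ∃ l, l ≠ i₀ ∧ slack l = x := by
      intro x hx
      obtain ⟨l, -, rfl⟩ := mem_image.1 (hdS hx)
      exact ⟨l, fun h => hzd (h ▸ hx), rfl⟩
    have hdom : IsDominant r d := by
      intro y
      by_cases hy : y ∈ Set.range slack
      · obtain ⟨l, rfl⟩ := hy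
        refine ⟨l, fun x hx => ?_⟩
        by_cases hxl : x = slack l
        · rw [hxl]
        · exact (hs.bot l x hxl).le
      · refine ⟨i₀, fun x hx => ?_⟩
        obtain ⟨l, hl, rfl⟩ := hslack x hx
        exact (hs.top i₀ l y hl hy).le
    obtain ⟨j, hj, hmj⟩ := hslack _ (hm i₀)
    have hmij : m i₀ = m j := by rw [hml j hj, hmj]
    obtain ⟨v, hv⟩ := hV
    have hvne : ∀ l, v ≠ slack l := fun l h => hv ⟨l, h.symm⟩
    have hvM : ∀ l, l ≠ i₀ → r l (m l) < r l v := by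
      intro l hl
      rw [hml l hl]
      exact hs.bot l v (hvne l)
    obtain ⟨x, hx⟩ := exists_isPivot r m i₀ ⟨v, hvM⟩
    have hxne : x ≠ slack i₀ := by
      rintro rfl
      exact absurd (hs.bot i₀ v (hvne i₀)) (not_lt.2 (hx.2 v hvM))
    -- Such a `y` would exceed `slack j` in rank `i₀`, so it is not ordinary, and no slack point
    -- meets all the strict inequalities.
    have hno : ∀ y, ¬ IsPivot r m j y := by
      intro y hy
      by_cases hyr : y ∈ Set.range slack
      · obtain ⟨p, rfl⟩ := hyr
        by_cases hp : p = i₀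
        · subst hp
          have h1 := hy.1 p hj.symm
          by_cases h2 : m p = slack p
          · rw [h2] at h1; exact lt_irrefl _ h1
          · exact absurd (hs.bot p _ h2) (not_lt.2 h1.le)
        by_cases hpj : p = j
        · subst hpj
          have h1 := hy.1 i₀ hj.symm
          rw [hmij, hml p hj] at h1
          exact lt_irrefl _ h1
        · have h1 := hy.1 p hpj
          rw [hml p hp] at h1
          exact lt_irrefl _ h1
      · have h1 := hy.1 i₀ hj.symm
        rw [hmij, hml j hj] at h1
        exact absurd (hs.top i₀ j y hj hyr) (not_lt.2 h1.le)
    have hxd := hx.notMem hr hdom hm hle hj.symm hmij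
    have : ({s ∈ ({s | #s = Fintype.card I ∧ (IsDominant r s ∨ s = univ.image slack)} :
        Finset (Finset V)) | d ⊆ s}) = {insert x d, insert (slack i₀) d} := by
      ext s
      simp only [mem_filter, mem_univ, true_and, mem_insert, mem_singleton]
      constructor
      · rintro ⟨⟨h1, h2⟩, h3⟩
        rcases h2 with h2 | h2
        · left
          obtain ⟨y, hyd, rfl⟩ := hinsert s h1 h3
          rcases isPivot_of_isDominant_insert hr hcard hm hle hj.symm hmij hyd h2 with h4 | h4
          · rw [h4.eq hr hx]
          · exact absurd h4 (hno y)
        · right; rw [h2, hz]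
      · rintro (rfl | rfl)
        · exact ⟨⟨by rw [card_insert_of_notMem hxd, hcard],
            Or.inl (hx.isDominant_insert hdom hm hle)⟩, subset_insert _ _⟩
        · exact ⟨⟨by rw [card_insert_of_notMem hzd, hcard], Or.inr hz.symm⟩, subset_insert _ _⟩
    rw [this, card_pair]
    · exact even_two
    · intro h
      have : x ∈ insert (slack i₀) d := h ▸ mem_insert_self x d
      rcases mem_insert.1 this with h | h
      · exact hxne h
      · exact hxd h
  by_cases hdom : IsDominant r d
  · obtain ⟨v, hvd, hv⟩ : ∃ v ∈ d, v ∉ Set.range slack := by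
      obtain ⟨v, hvd, hv⟩ := not_subset.1 hdS
      exact ⟨v, hvd, fun ⟨l, hl⟩ => hv (hl ▸ mem_image_of_mem _ (mem_univ l))⟩
    have hM : ∀ k, ∃ y, ∀ l, l ≠ k → r l (m l) < r l y := by
      refine fun k => ⟨slack k, fun l hl => ?_⟩
      exact (hle l v hvd).trans_lt (hs.top l k v hl.symm hv)
    obtain ⟨i, j, hij, hmij⟩ := exists_common_minimizer hr hdom hcard hm hle
    obtain ⟨x, hx⟩ := exists_isPivot r m i (hM i)
    obtain ⟨y, hy⟩ := exists_isPivot r m j (hM j)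
    have hxd := hx.notMem hr hdom hm hle hij hmij
    have hyd := hy.notMem hr hdom hm hle hij.symm hmij.symm
    have : ({s ∈ ({s | #s = Fintype.card I ∧ (IsDominant r s ∨ s = univ.image slack)} :
        Finset (Finset V)) | d ⊆ s}) = {insert x d, insert y d} := by
      ext s
      simp only [mem_filter, mem_univ, true_and, mem_insert, mem_singleton]
      constructor
      · rintro ⟨⟨h1, h2⟩, h3⟩
        rcases h2 with h2 | h2
        · obtain ⟨z, hzd, rfl⟩ := hinsert s h1 h3
          rcases isPivot_of_isDominant_insert hr hcard hm hle hij hmij hzd h2 with h4 | h4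
          · left; rw [h4.eq hr hx]
          · right; rw [h4.eq hr hy]
        · exact absurd (h2 ▸ h3) hdS
      · rintro (rfl | rfl)
        · exact ⟨⟨by rw [card_insert_of_notMem hxd, hcard],
            Or.inl (hx.isDominant_insert hdom hm hle)⟩, subset_insert _ _⟩
        · exact ⟨⟨by rw [card_insert_of_notMem hyd, hcard],
            Or.inl (hy.isDominant_insert hdom hm hle)⟩, subset_insert _ _⟩
    rw [this, card_pair]
    · exact even_two
    · intro h
      have : x ∈ insert y d := h ▸ mem_insert_self x d
      rcases mem_insert.1 this with h | h
      · exact hx.ne hdom hm hij hy h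
      · exact hxd h
  · rw [filter_eq_empty_iff.2]
    · simp
    · intro s hs' hds
      rcases (mem_filter.1 hs').2.2 with h | h
      · exact hdom (h.mono hds)
      · exact hdS (h ▸ hds)

open Finset in
/-- Scarf's lemma: there is a dominant set carrying all colours. -/
theorem exists_rainbow_isDominant {V I : Type*} [Fintype V] [DecidableEq V] [Fintype I]
    [DecidableEq I] [Nontrivial I] {r : I → V → ℕ} (hr : ∀ i, Function.Injective (r i))
    {slack : I → V} (hs : IsSlack r slack)
    (hV : ∃ v, v ∉ Set.range slack) (c : V → I) (hc : ∀ i, c (slack i) = i) :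
    ∃ s : Finset V, #s = Fintype.card I ∧ IsDominant r s ∧ s.image c = univ := by
  classical
  have hinj : Function.Injective slack := fun i j h => by rw [← hc i, h, hc j]
  obtain ⟨i₀⟩ : Nonempty I := inferInstance
  have heven := even_card_rainbow
    ({s | #s = Fintype.card I ∧ (IsDominant r s ∨ s = univ.image slack)} : Finset (Finset V)) c i₀
    (fun s h => (mem_filter.1 h).2.1) (even_card_rooms hr hinj hs hV)
  have hmem : univ.image slack ∈ ({s ∈ ({s | #s = Fintype.card I ∧
      (IsDominant r s ∨ s = univ.image slack)} : Finset (Finset V)) | s.image c = univ}) := by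
    simp only [mem_filter, mem_univ, true_and, or_true, and_true]
    refine ⟨by rw [card_image_of_injective _ hinj, card_univ], ?_⟩
    ext i
    simp [hc]
  have hlt : 1 < #({s ∈ ({s | #s = Fintype.card I ∧
      (IsDominant r s ∨ s = univ.image slack)} : Finset (Finset V)) | s.image c = univ}) := by
    have hpos := card_pos.2 ⟨_, hmem⟩
    obtain ⟨k, hk⟩ := heven
    omega
  obtain ⟨s, hs1, hs2⟩ := exists_mem_ne hlt (univ.image slack)
  simp only [mem_filter, mem_univ, true_and] at hs1
  exact ⟨s, hs1.1.1, hs1.1.2.resolve_right hs2, hs1.2⟩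

/-! ### From lattice points to the KKM lemma -/

open Finset in
theorem exists_close_lattice_points {I : Type*} [Fintype I] [DecidableEq I] [Nontrivial I] (N : ℕ)
    (c : (I → ℕ) → I) :
    ∃ x : I → ℕ, ∑ i, x i = N ∧ ∀ i, x i < Fintype.card I ∨ ∃ p : I → ℕ, ∑ j, p j = N ∧ c p = i ∧
      ∀ j, p j < x j + Fintype.card I ∧ x j < p j + Fintype.card I := by
  classical
  let T := {x : I → ℕ // x ∈ piAntidiag univ N}
  have hT : ∀ x : T, ∑ i, x.1 i = N := fun x => (mem_piAntidiag.1 x.2).1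
  have hmk : ∀ x : I → ℕ, ∑ i, x i = N → x ∈ piAntidiag univ N := fun x hx => by
    simpa [mem_piAntidiag] using hx
  let V := T ⊕ I
  let _ : Fintype T := inferInstanceAs (Fintype {x : I → ℕ // x ∈ piAntidiag univ N})
  let _ : Fintype V := inferInstanceAs (Fintype (T ⊕ I))
  -- Coordinates are shifted by one to leave level `0` for the slack point `i`; level `N + 2`
  -- exceeds every coordinate. Ties are broken by `idx`.
  let lev : I → V → ℕ := fun i => Sum.elim (fun x => x.1 i + 1) (fun j => if j = i then 0 else N + 2)
  let idx : V → Fin (Fintype.card V) := Fintype.equivFin V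
  let r : I → V → ℕ := fun i v => lev i v * Fintype.card V + idx v
  have hlev_lt : ∀ i v w, lev i v < lev i w → r i v < r i w := by
    intro i v w h
    have h1 : (lev i v + 1) * Fintype.card V ≤ lev i w * Fintype.card V :=
      Nat.mul_le_mul_right _ h
    have h2 := (idx v).2
    simp only [r]
    linarith
  have hlev_le : ∀ i v w, r i v ≤ r i w → lev i v ≤ lev i w := fun i v w h => by
    by_contra! h'
    exact absurd (hlev_lt i w v h') (not_lt.2 h)
  have hr : ∀ i, Function.Injective (r i) := by
    intro i v w h
    have h1 : lev i v = lev i w := le_antisymm (hlev_le i v w h.le) (hlev_le i w v h.ge)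
    simp only [r, h1, Nat.add_left_cancel_iff] at h
    exact (Fintype.equivFin V).injective (Fin.ext h)
  have hle_N : ∀ (x : T) i, x.1 i ≤ N := fun x i =>
    (single_le_sum (f := x.1) (fun _ _ => Nat.zero_le _) (mem_univ i)).trans (hT x).le
  have hs : IsSlack r (Sum.inr : I → V) := by
    constructor
    · rintro i (x | j) hv <;> apply hlev_lt
      · simp [lev]
      · have : j ≠ i := fun h => hv (h ▸ rfl)
        simp [lev, this]
    · rintro i j (x | k) hj hv <;> apply hlev_lt
      · have := hle_N x i
        simp only [lev, Sum.elim_inl, Sum.elim_inr, if_neg hj]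
        omega
      · exact absurd ⟨k, rfl⟩ hv
  obtain ⟨i₀⟩ : Nonempty I := inferInstance
  let y₀ : T := ⟨Pi.single i₀ N, hmk _ (by simp)⟩
  obtain ⟨s, -, hdom, hcol⟩ := exists_rainbow_isDominant hr hs ⟨Sum.inl y₀, by simp⟩
    (Sum.elim (fun x => c x.1) id) (fun i => rfl)
  -- For `i ∈ C`, colour `i` must come from a lattice point of `s`. Dominance at a lattice point is
  -- never witnessed outside `C`, where a slack point has level `0`.
  let C : Finset I := {i | (Sum.inr i : V) ∉ s}
  let σ : Finset T := {x | (Sum.inl x : V) ∈ s}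
  have hkey : ∀ y : T, ∃ i ∈ C, ∀ x ∈ σ, y.1 i ≤ x.1 i := by
    intro y
    obtain ⟨i, hi⟩ := hdom (Sum.inl y)
    refine ⟨i, ?_, fun x hx => ?_⟩
    · simp only [C, mem_filter, mem_univ, true_and]
      intro hmem
      have := hlev_le _ _ _ (hi _ hmem)
      simp [lev] at this
    · have := hlev_le _ _ _ (hi _ (mem_filter.1 hx).2)
      simpa [lev] using this
  have hcolor : ∀ i ∈ C, ∃ x ∈ σ, c x.1 = i := by
    intro i hi
    obtain ⟨v, hv, hvi⟩ := mem_image.1 (hcol ▸ mem_univ i)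
    rcases v with x | j
    · exact ⟨x, by simpa [σ] using hv, hvi⟩
    · simp only [Sum.elim_inr, id] at hvi
      subst hvi
      exact absurd hv (mem_filter.1 hi).2
  obtain ⟨i₁, hi₁, -⟩ := hkey y₀
  obtain ⟨x₀, hx₀, -⟩ := hcolor i₁ hi₁
  choose μ hμσ hμ using fun i => σ.exists_min_image (fun x => x.1 i) ⟨x₀, hx₀⟩
  -- Otherwise a lattice point could exceed every minimum `μ i` on `C`, with the surplus put on
  -- `i₁`, against dominance. Hence the minima on `C` sum to more than `N - #C`, which leaves each
  -- coordinate of a point of `σ` little room to vary.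
  have hsum : N < ∑ i ∈ C, ((μ i).1 i + 1) := by
    by_contra! hle
    let y : I → ℕ := fun j => if j ∈ C then
      ((μ j).1 j + 1) + (if j = i₁ then N - ∑ i ∈ C, ((μ i).1 i + 1) else 0) else 0
    have hy : ∑ j, y j = N := by
      simp only [y]
      rw [← sum_filter, filter_mem_eq_inter, univ_inter, sum_add_distrib, sum_ite_eq' C i₁,
        if_pos hi₁]
      omega
    obtain ⟨i, hi, hyi⟩ := hkey ⟨y, hmk y hy⟩
    have := hyi _ (hμσ i)
    simp only [y, if_pos hi] at this
    omega
  rw [sum_add_distrib, sum_const, smul_eq_mul, mul_one] at hsum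
  have hC : #C ≤ Fintype.card I := card_le_univ C
  have hsplit : ∀ x : T, ∑ j ∈ C, x.1 j + ∑ j ∈ Cᶜ, x.1 j = N := fun x => by
    rw [sum_add_sum_compl, hT]
  have hin : ∀ x ∈ σ, ∀ j ∈ C, x.1 j < (μ j).1 j + Fintype.card I := by
    intro x hx j hj
    have h1 := add_sum_erase C x.1 hj
    have h2 := add_sum_erase C (fun i => (μ i).1 i) hj
    have h3 : ∑ i ∈ C.erase j, (μ i).1 i ≤ ∑ i ∈ C.erase j, x.1 i :=
      sum_le_sum fun i _ => hμ i x hx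
    have := hsplit x
    omega
  have hout : ∀ x ∈ σ, ∀ j ∉ C, x.1 j < Fintype.card I := by
    intro x hx j hj
    have h1 : x.1 j ≤ ∑ j ∈ Cᶜ, x.1 j :=
      single_le_sum (f := x.1) (fun _ _ => Nat.zero_le _) (mem_compl.2 hj)
    have h3 : ∑ i ∈ C, (μ i).1 i ≤ ∑ i ∈ C, x.1 i := sum_le_sum fun i _ => hμ i x hx
    have := hsplit x
    omega
  have hclose : ∀ x ∈ σ, ∀ p ∈ σ, ∀ j, p.1 j < x.1 j + Fintype.card I := by
    intro x hx p hp j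
    by_cases hj : j ∈ C
    · exact (hin p hp j hj).trans_le (Nat.add_le_add_right (hμ j x hx) _)
    · exact (hout p hp j hj).trans_le (Nat.le_add_left _ _)
  refine ⟨x₀.1, hT x₀, fun i => ?_⟩
  by_cases hi : i ∈ C
  · obtain ⟨p, hp, hpi⟩ := hcolor i hi
    exact Or.inr ⟨p.1, hT p, hpi, fun j => ⟨hclose x₀ hx₀ p hp j, hclose p hp x₀ hx₀ j⟩⟩
  · exact Or.inl (hout x₀ hx₀ i hi)

open Filter Topology in
/-- A closed cover of the standard simplex indexed by the vertices has a point lying in every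
member of the cover whose index belongs to its support. -/
theorem exists_mem_stdSimplex_of_closed_cover {I : Type*} [Fintype I] [Nonempty I]
    (A : I → Set (I → ℝ)) (hA : ∀ i, IsClosed (A i))
    (hcover : ∀ x ∈ stdSimplex ℝ I, ∃ i, x ∈ A i) :
    ∃ x ∈ stdSimplex ℝ I, ∀ i, x i = 0 ∨ x ∈ A i := by
  classical
  rcases subsingleton_or_nontrivial I with hI | hI
  · obtain ⟨i₀⟩ : Nonempty I := inferInstance
    have hx := single_mem_stdSimplex ℝ i₀
    obtain ⟨i, hi⟩ := hcover _ hx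
    exact ⟨_, hx, fun j => Or.inr (Subsingleton.elim i j ▸ hi)⟩
  let scale : ℕ → (I → ℕ) → I → ℝ := fun n p i => p i / (n + 1 : ℝ)
  have hn : ∀ n : ℕ, (0 : ℝ) < n + 1 := fun n => by positivity
  have hscale : ∀ n p, ∑ i, p i = n + 1 → scale n p ∈ stdSimplex ℝ I := by
    intro n p hp
    refine ⟨fun i => by positivity, ?_⟩
    simp only [scale]
    rw [← Finset.sum_div, div_eq_one_iff_eq (hn n).ne']
    exact_mod_cast hp
  have happrox : ∀ n : ℕ, ∃ u ∈ stdSimplex ℝ I, ∀ i, u i < Fintype.card I / (n + 1 : ℝ) ∨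
      ∃ q ∈ A i, dist q u ≤ Fintype.card I / (n + 1 : ℝ) := by
    intro n
    obtain ⟨x, hx, h⟩ := exists_close_lattice_points (I := I) (n + 1)
      (fun p => if h : ∃ i, scale n p ∈ A i then h.choose else Classical.arbitrary I)
    refine ⟨scale n x, hscale n x hx, fun i => ?_⟩
    rcases h i with h | ⟨p, hp, hpi, hpx⟩
    · left
      simp only [scale]
      have : (x i : ℝ) < Fintype.card I := by exact_mod_cast h
      gcongr
    · right
      have hex := hcover _ (hscale n p hp)
      rw [dif_pos hex] at hpi
      refine ⟨scale n p, hpi ▸ hex.choose_spec, (dist_pi_le_iff (by positivity)).2 fun j => ?_⟩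
      rw [Real.dist_eq, ← sub_div, abs_div, abs_of_pos (hn n)]
      have h1 : (p j : ℝ) < x j + Fintype.card I := by exact_mod_cast (hpx j).1
      have h2 : (x j : ℝ) < p j + Fintype.card I := by exact_mod_cast (hpx j).2
      gcongr
      rw [abs_le]
      constructor <;> linarith
  choose u hu hu' using happrox
  obtain ⟨x, hx, φ, hφ, hlim⟩ := (isCompact_stdSimplex ℝ I).tendsto_subseq hu
  refine ⟨x, hx, fun i => ?_⟩
  by_contra! hi
  have hxi : 0 < x i := lt_of_le_of_ne (hx.1 i) hi.1.symm
  obtain ⟨ε, hε, hball⟩ := Metric.isOpen_iff.1 (hA i).isOpen_compl x hi.2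
  -- One `δ` bounds the distance from `u` to `x`, another the lattice error; their sum must not
  -- exceed `ε` or `x i`.
  set δ := min ε (x i) / 2 with hδ
  have hδε : δ + δ ≤ ε := by rw [hδ, add_halves]; exact min_le_left _ _
  have hδx : δ + δ ≤ x i := by rw [hδ, add_halves]; exact min_le_right _ _
  have hδ0 : 0 < δ := by positivity
  have hsmall : Tendsto (fun n : ℕ => (Fintype.card I : ℝ) / (n + 1 : ℝ)) atTop (𝓝 0) :=
    (tendsto_const_div_atTop_nhds_zero_nat (Fintype.card I : ℝ) |>.comp (tendsto_add_atTop_nat 1)).congr fun n => by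
      simp
  obtain ⟨n, hn1, hn2⟩ := ((Metric.tendsto_nhds.1 hlim δ hδ0).and
    ((hsmall.comp hφ.tendsto_atTop).eventually_lt_const hδ0)).exists
  simp only [Function.comp_apply] at hn1 hn2
  rcases hu' (φ n) i with h | ⟨q, hq, hqu⟩
  · have h1 := (dist_le_pi_dist (u (φ n)) x i).trans_lt hn1
    rw [Real.dist_eq, abs_lt] at h1
    linarith [h1.1]
  · refine hball (Metric.mem_ball.2 ?_) hq
    linarith [dist_triangle q (u (φ n)) x]

/-- The Knaster–Kuratowski–Mazurkiewicz lemma on the standard simplex. -/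
theorem kkm_stdSimplex {I : Type*} [Fintype I] [Nonempty I]
    (C : I → Set (I → ℝ)) (hC : ∀ i, IsClosed (C i))
    (hcover : ∀ x ∈ stdSimplex ℝ I, ∃ i, x i ≠ 0 ∧ x ∈ C i) :
    ∃ x ∈ stdSimplex ℝ I, ∀ i, x ∈ C i := by
  classical
  -- Needed because `infDist` to the empty set is `0`.
  have hne : ∀ i, (C i).Nonempty := by
    intro i
    obtain ⟨j, hj, hjC⟩ := hcover _ (single_mem_stdSimplex ℝ i)
    have : j = i := by
      by_contra h
      exact hj (by simp [h])
    exact ⟨_, this ▸ hjC⟩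
  have hd : ∀ x i, 0 ≤ Metric.infDist x (C i) := fun x i => Metric.infDist_nonneg
  -- These sets cover because the weights `x i` sum to `1`. At the point obtained, an index with `x
  -- i ≠ 0` and `x ∈ C i` forces the sum of all distances to vanish.
  obtain ⟨x, hx, h⟩ := exists_mem_stdSimplex_of_closed_cover
    (fun i => {x | x i * ∑ j, Metric.infDist x (C j) ≤ Metric.infDist x (C i)})
    (fun i => isClosed_le
      ((continuous_apply i).mul (continuous_finsetSum _ fun j _ => Metric.continuous_infDist_pt _))
      (Metric.continuous_infDist_pt _)) (by
    intro x hx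
    by_contra! hlt
    simp only [Set.mem_ofPred_eq, not_le] at hlt
    have := Finset.sum_lt_sum_of_nonempty Finset.univ_nonempty fun i _ => hlt i
    rw [← Finset.sum_mul, hx.2, one_mul] at this
    exact lt_irrefl _ this)
  refine ⟨x, hx, fun j => ?_⟩
  obtain ⟨i, hi, hiC⟩ := hcover x hx
  have h1 : x i * ∑ j, Metric.infDist x (C j) ≤ 0 := by
    have := (h i).resolve_left hi
    rwa [Set.mem_ofPred_eq, Metric.infDist_zero_of_mem hiC] at this
  have hxi : 0 < x i := lt_of_le_of_ne (hx.1 i) hi.symm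
  have h2 : ∑ j, Metric.infDist x (C j) ≤ 0 := nonpos_of_mul_nonpos_right h1 hxi
  have h3 : Metric.infDist x (C j) ≤ ∑ j, Metric.infDist x (C j) :=
    Finset.single_le_sum (f := fun j => Metric.infDist x (C j)) (fun j _ => hd x j)
      (Finset.mem_univ j)
  rw [(hC j).mem_iff_infDist_zero (hne j)]
  exact le_antisymm (h3.trans h2) (hd x j)

/-- The Knaster–Kuratowski–Mazurkiewicz lemma for finitely many points of a topological vector
space. -/
theorem kkm_of_finite {X I : Type*} [AddCommGroup X] [Module ℝ X] [TopologicalSpace X]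
    [ContinuousAdd X] [ContinuousSMul ℝ X] [Fintype I] [Nonempty I] (y : I → X)
    (G : I → Set X) (hG : ∀ i, IsClosed (G i))
    (hcover : ∀ w ∈ stdSimplex ℝ I, ∃ i, w i ≠ 0 ∧ ∑ j, w j • y j ∈ G i) :
    ∃ x ∈ convexHull ℝ (Set.range y), ∀ i, x ∈ G i := by
  have hcont : Continuous fun w : I → ℝ => ∑ j, w j • y j := by fun_prop
  obtain ⟨w, hw, h⟩ := kkm_stdSimplex (fun i => (fun w : I → ℝ => ∑ j, w j • y j) ⁻¹' G i)
    (fun i => (hG i).preimage hcont) hcover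
  exact ⟨_, (convex_convexHull ℝ _).sum_mem (fun i _ => hw.1 i) hw.2
    fun i _ => subset_convexHull ℝ _ ⟨i, rfl⟩, h⟩

/-! ### Self segment-density and the minimax inequality -/

/-- Induction on `s`: a point of the larger hull lies on a segment from `x` to some `z'` in the
smaller one. Approximating `z'` by points `v ∈ D` of that hull gives segments with both ends in `D`,
where `D` is dense. -/
theorem IsSelfSegmentDense.convexHull_subset_closure {X : Type*} [AddCommGroup X] [Module ℝ X]
    [TopologicalSpace X] [ContinuousAdd X] [ContinuousSMul ℝ X] {D K : Set X}
    (hD : IsSelfSegmentDense D K) {s : Set X} (hs : s.Finite) (hsD : s ⊆ D) :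
    convexHull ℝ s ⊆ closure (convexHull ℝ s ∩ D) := by
  induction s, hs using Set.Finite.induction_on with
  | empty => simp
  | @insert x s _ _ ih =>
    have hx : x ∈ D := hsD (Set.mem_insert x s)
    have ih := ih ((Set.subset_insert x s).trans hsD)
    rcases s.eq_empty_or_nonempty with rfl | hne
    · have hxs : x ∈ convexHull ℝ (insert x (∅ : Set X)) :=
        subset_convexHull ℝ _ (Set.mem_insert x _)
      intro z hz
      have : z = x := by simpa using hz
      subst this
      exact subset_closure ⟨hxs, hx⟩
    · intro z hz
      rw [convexHull_insert hne, mem_convexJoin] at hz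
      obtain ⟨x', hx', z', hz', a, b, ha, hb, hab, rfl⟩ := hz
      rw [Set.mem_singleton_iff] at hx'
      subst hx'
      have hmaps : Set.MapsTo (fun v => a • x' + b • v) (convexHull ℝ s ∩ D)
          (closure (convexHull ℝ (insert x' s) ∩ D)) := by
        rintro v ⟨hv, hvD⟩
        refine closure_mono (Set.inter_subset_inter_left _ ?_)
          (hD.segment_dense x' hx v hvD ⟨a, b, ha, hb, hab, rfl⟩)
        exact (convex_convexHull ℝ _).segment_subset
          (subset_convexHull ℝ _ (Set.mem_insert x' s))
          (convexHull_mono (Set.subset_insert x' s) hv)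
      have hcont : Continuous fun v : X => a • x' + b • v := by fun_prop
      exact isClosed_closure.closure_subset (hmaps.closure hcont (ih hz'))

/-- On a convex hull of points of `D`, a function that is convex on `D` and nonnegative at a point
of `D` is nonnegative at one of the points generating the hull. -/
theorem IsConvexFunctionOn.exists_nonneg {X : Type*} [AddCommGroup X] [Module ℝ X] {D : Set X}
    {f : X → ℝ} (hf : IsConvexFunctionOn D f) {s : Set X} (hsD : s ⊆ D) {x : X} (hxD : x ∈ D)
    (hx : x ∈ convexHull ℝ s) (h0 : 0 ≤ f x) : ∃ y ∈ s, 0 ≤ f y := by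
  by_contra! hneg
  obtain ⟨ι, _, w, z, hw, hw1, hz, rfl⟩ := mem_convexHull_iff_exists_fintype.1 hx
  let e := (Fintype.equivFin ι).symm
  have hsum : ∑ i, w (e i) • z (e i) = ∑ i, w i • z i :=
    e.sum_comp fun i => w i • z i
  have hw1' : ∑ i, w (e i) = 1 := by rw [e.sum_comp w, hw1]
  have hle := hf _ (fun i => z (e i)) (fun i => w (e i)) (fun i => hsD (hz _)) (fun i => hw _)
    hw1' (hsum ▸ hxD)
  rw [hsum] at hle
  obtain ⟨i, -, hi⟩ : ∃ i ∈ Finset.univ, 0 < w (e i) := by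
    by_contra! hle0
    linarith [Finset.sum_nonpos hle0]
  have : ∑ i, w (e i) * f (z (e i)) < 0 :=
    Finset.sum_neg' (fun i _ => mul_nonpos_of_nonneg_of_nonpos (hw _) (hneg _ (hz _)).le)
      ⟨i, Finset.mem_univ i, mul_neg_of_pos_of_neg hi (hneg _ (hz _))⟩
  linarith

theorem IsCompact.isClosed_setOf_nonneg {X : Type*} [TopologicalSpace X] [T2Space X] {K : Set X}
    (hK : IsCompact K) {f : X → ℝ} (hf : UpperSemicontinuousOn f K) :
    IsClosed {x ∈ K | 0 ≤ f x} := by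
  refine isClosed_of_closure_subset fun x hx => ?_
  have hxK : x ∈ K := hK.isClosed.closure_subset_iff.2 (fun _ h => h.1) hx
  refine ⟨hxK, ?_⟩
  by_contra! hlt
  have h1 := eventually_nhdsWithin_iff.1 (hf x hxK 0 hlt)
  obtain ⟨z, ⟨hzK, hz0⟩, hz⟩ := ((mem_closure_iff_frequently.1 hx).and_eventually h1).exists
  exact absurd (hz hzK) (not_lt.2 hz0)

theorem theorem3p6 {X : Type*} [AddCommGroup X] [Module ℝ X] [TopologicalSpace X]
    [IsTopologicalAddGroup X] [ContinuousSMul ℝ X] [LocallyConvexSpace ℝ X] [T2Space X]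
    (K D : Set X) (hK_nonempty : K.Nonempty) (hK_convex : Convex ℝ K) (hK_compact : IsCompact K)
    (hD : IsSelfSegmentDense D K)
    -- only the values of `φ` on `K × K` matter
    (φ : X → X → ℝ)
    (h_usc_left : ∀ y ∈ D, UpperSemicontinuousOn (fun x => φ x y) K)
    -- upper semicontinuity, at each point of `K \ D`, of the function `φ x` defined on `K`
    (h_usc_right : ∀ x ∈ K, ∀ y ∈ K \ D, UpperSemicontinuousWithinAt (fun z => φ x z) K y)
    (h_convex : ∀ x ∈ D, IsConvexFunctionOn D (fun y => φ x y))
    (h_diag : ∀ x ∈ D, 0 ≤ φ x x) :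
    ∃ x₀ ∈ K, ∀ y ∈ K, 0 ≤ φ x₀ y := by
  have hclosed : ∀ y : D, IsClosed {x ∈ K | 0 ≤ φ x y} := fun y =>
    hK_compact.isClosed_setOf_nonneg (h_usc_left y y.2)
  have hfin : ∀ t : Finset D, (K ∩ ⋂ y ∈ t, {x ∈ K | 0 ≤ φ x y}).Nonempty := by
    intro t
    rcases t.eq_empty_or_nonempty with rfl | hne
    · simpa using hK_nonempty
    have : Nonempty t := hne.to_subtype
    obtain ⟨x, hx, hxG⟩ := kkm_of_finite (fun y : t => (y : X))
      (fun y : t => {x ∈ K | 0 ≤ φ x y}) (fun y => hclosed y) (by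
      intro w hw
      -- Only the support of `w` generates the hull, so the index found below has nonzero weight, as
      -- KKM requires.
      let s : Set X := (fun y : t => (y : X)) '' {y | w y ≠ 0}
      have hsD : s ⊆ D := by
        rintro _ ⟨y, -, rfl⟩
        exact y.1.2
      have hsfin : s.Finite := (Set.toFinite _).image _
      have hmem : ∑ y, w y • (y : X) ∈ convexHull ℝ s := by
        classical
        rw [← Finset.sum_filter_of_ne (p := fun y => w y ≠ 0)
          (fun y _ h h0 => h (by rw [h0, zero_smul]))]
        refine (convex_convexHull ℝ s).sum_mem (fun y _ => hw.1 y) ?_ fun y hy =>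
          subset_convexHull ℝ _ ⟨y, (Finset.mem_filter.1 hy).2, rfl⟩
        rw [Finset.sum_filter_ne_zero, hw.2]
      have hsub : convexHull ℝ s ∩ D ⊆
          ⋃ y ∈ {y : t | w y ≠ 0}, {x ∈ K | 0 ≤ φ x y} := by
        rintro x ⟨hx, hxD⟩
        obtain ⟨_, ⟨y, hy, rfl⟩, h0⟩ :=
          (h_convex x hxD).exists_nonneg hsD hxD hx (h_diag x hxD)
        exact Set.mem_biUnion hy ⟨hD.subset hxD, h0⟩
      have hUclosed : IsClosed (⋃ y ∈ {y : t | w y ≠ 0}, {x ∈ K | 0 ≤ φ x y}) :=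
        (Set.toFinite _).isClosed_biUnion fun y _ => hclosed y
      have := hUclosed.closure_subset_iff.2 hsub
        (hD.convexHull_subset_closure hsfin hsD hmem)
      simp only [Set.mem_iUnion] at this
      obtain ⟨y, hy, h⟩ := this
      exact ⟨y, hy, h⟩)
    refine ⟨x, ?_, Set.mem_iInter₂.2 fun y hy => hxG ⟨y, hy⟩⟩
    obtain ⟨y⟩ := this
    exact (hxG y).1
  obtain ⟨x₀, hx₀K, hx₀⟩ := hK_compact.inter_iInter_nonempty _ hclosed hfin
  have hx₀D : ∀ y ∈ D, 0 ≤ φ x₀ y := fun y hy => (Set.mem_iInter.1 hx₀ ⟨y, hy⟩).2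
  refine ⟨x₀, hx₀K, fun y hy => ?_⟩
  by_cases hyD : y ∈ D
  · exact hx₀D y hyD
  -- Negativity at `y` would persist on a neighbourhood in `K`, which meets `D` by density.
  by_contra! hlt
  have h1 := eventually_nhdsWithin_iff.1 (h_usc_right x₀ hx₀K y ⟨hy, hyD⟩ 0 hlt)
  obtain ⟨z, hzD, hz⟩ := ((mem_closure_iff_frequently.1 (hD.dense hy)).and_eventually h1).exists
  exact absurd (hz (hD.subset hzD)) (not_lt.2 (hx₀D z hzD))
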